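/- Let $\kappa$ be an uncountable regular cardinal. A filter or ultrafilter over $\kappa$ is $\kappa$-complete if it is closed under intersections of fewer than $\kappa$ of its members. Suppose that $\kappa$ is $\kappa$-compact, that is, every proper $\kappa$-complete filter over $\kappa$ extends to a $\kappa$-complete ultrafilter over $\kappa$. Then there is a $\kappa$-complete ultrafilter $U$ over $\kappa$ which is uniform (every member of $U$ has cardinality $\kappa$), is a $q$-point, and is Tukey-top among the $\kappa$-complete ultrafilters over $\kappa$. Here: - For partially ordered sets $P,Q$, $P\le_T Q$ means that there is a map $f:Q\to P$ such that $f[X]$ is cofinal in $P$ for every cofinal $X\subseteq Q$, and $P\equiv_T Q$ means $P\le_T Q$ and $Q\le_T P$. Ultrafilters are ordered by reverse inclusion. - $U$ is a $q$-point if every function $f:\kappa\to\kappa$ which is almost one-to-one modulo $U$ (there is $A\in U$ such that $A\cap f^{-1}\{\gamma\}$ is bounded in $\kappa$ for every $\gamma<\kappa$) is injective on some member of $U$. - $U$ is Tukey-top among the $\kappa$-complete ultrafilters if $(U,\supseteq)\equiv_T([2^\kappa]^{<\kappa},\subseteq)$, where $[2^\kappa]^{<\kappa}$ is the set of subsets of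 $2^\kappa$ of cardinality less than $\kappa$, and $(W,\supseteq)\le_T(U,\supseteq)$ for every $\kappa$-complete ultrafilter $W$ over $\kappa$. -/

import Mathlib

open Cardinal

universe u v w

/-- The cardinal `κ` viewed as a set: the initial ordinal of cardinality `κ`, with its
well-order. -/
abbrev CardSet (κ : Cardinal.{u}) : Type u := κ.ord.ToType

/-- `P ≤_T Q`: there is a cofinal map `f : Q → P`, that is, a map such that the image of every
cofinal subset of `Q` is cofinal in `P`. -/
def TukeyLE (P : Type v) (Q : Type w) [Preorder P] [Preorder Q] : Prop :=
  ∃ f : Q → P, ∀ X : Set Q, IsCofinal X → IsCofinal (f '' X)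

/-- Tukey equivalence `P ≡_T Q`. -/
def TukeyEquiv (P : Type v) (Q : Type w) [Preorder P] [Preorder Q] : Prop :=
  TukeyLE P Q ∧ TukeyLE Q P

/-- The set `[X]^{<κ}` of subsets of `X` of cardinality less than `κ`, ordered by inclusion. -/
abbrev SmallSubsets (X : Type u) (κ : Cardinal.{u}) : Type u := {s : Set X // #s < κ}

/-- The directed order `(U, ⊇)`: the members of `U`, ordered by reverse inclusion. -/
abbrev ReverseInclusion {X : Type u} (U : Ultrafilter X) : Type u := {A : Set X // A ∈ U}ᵒᵈ

/-- `κ` is `κ`-compact: every (proper) `κ`-complete filter on `κ` extends to a `κ`-complete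
ultrafilter. Here `CardinalInterFilter F κ` says that `F` is closed under intersections of fewer
than `κ` of its members, and `U ≤ F` that `F ⊆ U`. -/
def IsKappaCompact (κ : Cardinal.{u}) : Prop :=
  ∀ F : Filter (CardSet κ), F.NeBot → CardinalInterFilter F κ →
    ∃ U : Ultrafilter (CardSet κ),
      CardinalInterFilter (U : Filter (CardSet κ)) κ ∧ (U : Filter (CardSet κ)) ≤ F

/-- An ultrafilter on `κ` is uniform if all its members have cardinality `κ`. -/
def IsUniformUltrafilter {κ : Cardinal.{u}} (U : Ultrafilter (CardSet κ)) : Prop :=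
  ∀ A ∈ U, #A = κ

/-- `f : κ → κ` is almost one-to-one modulo `U`: on some member of `U` all its fibres are bounded
in `κ`. -/
def IsAlmostInjMod {κ : Cardinal.{u}} (U : Ultrafilter (CardSet κ))
    (f : CardSet κ → CardSet κ) : Prop :=
  ∃ A ∈ U, ∀ γ, BddAbove (A ∩ f ⁻¹' {γ})

/-- `U` is a `q`-point: every `f : κ → κ` which is almost one-to-one modulo `U` is injective on
some member of `U`. -/
def IsQPoint {κ : Cardinal.{u}} (U : Ultrafilter (CardSet κ)) : Prop :=
  ∀ f : CardSet κ → CardSet κ, IsAlmostInjMod U f → ∃ B ∈ U, Set.InjOn f B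

/-- `U` is Tukey-top: `(U, ⊇)` is Tukey equivalent to `([2^κ]^{<κ}, ⊆)`. -/
def IsTukeyTop {κ : Cardinal.{u}} (U : Ultrafilter (CardSet κ)) : Prop :=
  TukeyEquiv (ReverseInclusion U) (SmallSubsets (CardSet (2 ^ κ)) κ)

open Set Filter Order

section RegularCardinalOrder

variable {κ : Cardinal.{u}}

/-! Extend to a `κ`-complete ultrafilter `U` the filter generated by the clubs, an independent
family of `2^κ` sets, and the complements of all intersections of at least `κ` of these sets. Clubs
make `U` uniform and a q-point; the family gives `[2^κ]^{<κ} ≤_T U`. Conversely, any `κ`-complete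
ultrafilter lies below `[2^κ]^{<κ}`, having at most `2^κ` members and being closed under small
intersections. The filter is proper if independence holds modulo clubs
(`exists_independent_family`). Compactness makes `κ` a strong limit, so there are `κ` regular
cardinals below it; their cofinality classes are disjoint stationary sets, which carry Hausdorff's
coding. -/

theorem mk_cardSet (κ : Cardinal.{u}) : #(CardSet κ) = κ := by simp

theorem Cardinal.IsRegular.cof_cardSet (hκ : κ.IsRegular) : Order.cof (CardSet κ) = κ := by
  rw [Ordinal.cof_toType, hκ.cof_ord]

theorem Cardinal.IsRegular.isRegularCardinalOrder (hκ : κ.IsRegular) :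
    IsRegularCardinalOrder (CardSet κ) where
  type_lt_le_ord_cof := by rw [hκ.cof_cardSet, Ordinal.type_toType]

theorem Cardinal.IsRegular.noMaxOrder_cardSet (hκ : κ.IsRegular) : NoMaxOrder (CardSet κ) := by
  rw [← noTopOrder_iff_noMaxOrder, ← Order.cof_ne_one_iff, hκ.cof_cardSet]
  exact_mod_cast (hκ.nat_lt 1).ne'

theorem Cardinal.IsRegular.nonempty_cardSet (hκ : κ.IsRegular) : Nonempty (CardSet κ) := by
  rw [← Cardinal.mk_ne_zero_iff, mk_cardSet]
  exact hκ.ne_zero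

/-- A subset of a regular cardinal `κ` of cardinality less than `κ` is bounded. -/
theorem Cardinal.IsRegular.exists_forall_lt (hκ : κ.IsRegular) {s : Set (CardSet κ)}
    (hs : #s < κ) : ∃ a, ∀ b ∈ s, b < a := by
  rw [← not_isCofinal_iff]
  intro h
  exact ((Order.cof_le h).trans_lt hs).ne hκ.cof_cardSet

theorem Cardinal.IsRegular.exists_forall_range_lt (hκ : κ.IsRegular) {ι : Type u}
    (hι : #ι < κ) (f : ι → CardSet κ) : ∃ a, ∀ i, f i < a := by
  obtain ⟨a, ha⟩ := hκ.exists_forall_lt (s := range f) (mk_range_le.trans_lt hι)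
  exact ⟨a, fun i => ha _ ⟨i, rfl⟩⟩

theorem mk_Iio_cardSet_lt (a : CardSet κ) : #(Iio a) < κ := by
  simpa using mk_Iio_lt a

theorem Cardinal.IsRegular.mk_eq_of_not_bddAbove (hκ : κ.IsRegular) {s : Set (CardSet κ)}
    (hs : ¬ BddAbove s) : #s = κ := by
  refine ((mk_set_le s).trans_eq (mk_cardSet κ)).antisymm (not_lt.1 fun h => hs ?_)
  obtain ⟨a, ha⟩ := hκ.exists_forall_lt h
  exact ⟨a, fun b hb => (ha b hb).le⟩

/-! ### Clubs -/

theorem isClub_Ici {α : Type*} [LinearOrder α] (a : α) : IsClub (Ici a) where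
  dirSupClosed := by
    rintro s hs ⟨b, hb⟩ - x hx
    exact (hs hb).trans (hx.1 hb)
  isCofinal b := ⟨max a b, le_max_left a b, le_max_right a b⟩

theorem Cardinal.IsRegular.isClub_closedUnder (hκ : κ.IsRegular) (hunc : ℵ₀ < κ)
    (g : CardSet κ → CardSet κ) : IsClub {x | ∀ b < x, g b < x} where
  dirSupClosed := by
    rintro s hs - - x hx b hb
    obtain ⟨y, hy, hby⟩ := (lt_isLUB_iff hx).1 hb
    exact (hs hy b hby).trans_le (hx.1 hy)
  isCofinal a := by
    have := hκ.noMaxOrder_cardSet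
    have hstep : ∀ c : CardSet κ, ∃ d, c < d ∧ ∀ b < c, g b < d := by
      intro c
      obtain ⟨d, hd⟩ := hκ.exists_forall_range_lt (mk_Iio_cardSet_lt c) fun b : Iio c => g b
      obtain ⟨e, he⟩ := exists_gt c
      exact ⟨max d e, lt_max_of_lt_right he, fun b hb => lt_max_of_lt_left (hd ⟨b, hb⟩)⟩
    choose next hlt hnext using hstep
    let c : ℕ → CardSet κ := fun n => next^[n] a
    have hc : ∀ n, c (n + 1) = next (c n) := fun n => Function.iterate_succ_apply' _ _ _
    have hbdd : ∃ x, ∀ n, c n ≤ x := by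
      obtain ⟨x, hx⟩ := hκ.exists_forall_lt (s := range c)
        ((Set.countable_range c).le_aleph0.trans_lt hunc)
      exact ⟨x, fun n => (hx _ ⟨n, rfl⟩).le⟩
    -- For the supremum `x` of the iterates, each `b < x` lies below some `c n`, so `g b < c (n + 1)
    -- ≤ x`.
    let x := wellFounded_lt.min {x | ∀ n, c n ≤ x} hbdd
    have hx : ∀ n, c n ≤ x := wellFounded_lt.min_mem {x | ∀ n, c n ≤ x} hbdd
    refine ⟨x, fun b hb => ?_, hx 0⟩
    have : ¬ ∀ n, c n ≤ b := fun h => wellFounded_lt.not_lt_min {x | ∀ n, c n ≤ x} h hb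
    push Not at this
    obtain ⟨n, hn⟩ := this
    exact (hnext (c n) b hn).trans_le ((hc n).symm.le.trans (hx (n + 1)))

/-! ### Complete filters -/

theorem Cardinal.IsRegular.cardinalInterFilter_atTop (hκ : κ.IsRegular) :
    CardinalInterFilter (atTop : Filter (CardSet κ)) κ where
  cardinal_sInter_mem S hS h := by
    have := hκ.nonempty_cardSet
    have h' : ∀ s : S, ∃ a, ∀ b, a ≤ b → b ∈ s.1 := fun s => by
      simpa using mem_atTop_sets.1 (h s.1 s.2)
    choose f hf using h'
    obtain ⟨a, ha⟩ := hκ.exists_forall_range_lt hS f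
    exact mem_atTop_sets.2 ⟨a, fun b hb s hs => hf ⟨s, hs⟩ b ((ha _).le.trans hb)⟩

/-- A cardinal carrying a complete nonprincipal ultrafilter is a strong limit. -/
theorem two_power_lt_of_cardinalInterFilter (U : Ultrafilter (CardSet κ))
    (hUc : CardinalInterFilter (U : Filter (CardSet κ)) κ) (hU : ∀ x, {x} ∉ U)
    {c : Cardinal.{u}} (hc : c < κ) : 2 ^ c < κ := by
  by_contra! hle
  obtain ⟨F⟩ : Nonempty (CardSet κ ↪ Set c.out) := by
    rw [← Cardinal.le_def, mk_cardSet, mk_set, mk_out]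
    exact hle
  -- `U` decides each of the `c < κ` bits of `F x`; by completeness `F` is constant on a member of
  -- `U`, which is then a singleton.
  let T : Set c.out := {i | {x | i ∈ F x} ∈ U}
  have hT : (⋂ i, {x | i ∈ F x ↔ i ∈ T}) ∈ (U : Filter (CardSet κ)) := by
    refine (cardinal_iInter_mem (by rwa [mk_out])).2 fun i => ?_
    by_cases hi : i ∈ T
    · exact mem_of_superset (x := {x | i ∈ F x}) hi fun x hx => iff_of_true hx hi
    · exact mem_of_superset (x := {x | i ∈ F x}ᶜ) (Ultrafilter.compl_mem_iff_notMem.2 hi)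
        fun x hx => iff_of_false hx hi
  obtain ⟨x, hx⟩ := Ultrafilter.nonempty_of_mem hT
  have hF : ∀ y ∈ ⋂ i, {x | i ∈ F x ↔ i ∈ T}, F y = T := fun y hy => by
    ext i
    exact mem_iInter.1 hy i
  refine hU x (mem_of_superset hT fun y hy => ?_)
  exact F.injective ((hF y hy).trans (hF x hx).symm)

theorem IsKappaCompact.two_power_lt (hcomp : IsKappaCompact κ) (hκ : κ.IsRegular)
    {c : Cardinal.{u}} (hc : c < κ) : 2 ^ c < κ := by
  have := hκ.nonempty_cardSet
  have := hκ.noMaxOrder_cardSet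
  obtain ⟨U, hUc, hU⟩ := hcomp atTop inferInstance hκ.cardinalInterFilter_atTop
  refine two_power_lt_of_cardinalInterFilter U hUc (fun x hx => ?_) hc
  exact Ultrafilter.compl_notMem_iff.2 hx (mem_of_superset (hU (Ioi_mem_atTop x)) fun y hy => hy.ne')

/-! ### Disjoint stationary sets -/

theorem Cardinal.IsRegular.exists_cof_Iio_eq {c : Cardinal.{u}} (hc : c.IsRegular) (hcκ : c < κ) :
    ∃ x : CardSet κ, Order.cof (Iio x) = c := by
  have h : c.ord < Ordinal.type (α := CardSet κ) (· < ·) := by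
    rwa [Ordinal.type_toType, ord_lt_ord]
  refine ⟨Ordinal.enum (α := CardSet κ) (· < ·) ⟨c.ord, h⟩, ?_⟩
  rw [Order.cof_Iio, Ordinal.typein_enum, hc.cof_ord]

theorem isSuccLimit_of_aleph0_le_cof {α : Type*} [LinearOrder α] {x : α}
    (hx : ℵ₀ ≤ Order.cof (Iio x)) : IsSuccLimit x := by
  have h1 : Order.cof (Iio x) ≠ 1 := (one_lt_aleph0.trans_le hx).ne'
  have h0 : Order.cof (Iio x) ≠ 0 := (aleph0_pos.trans_le hx).ne'
  rw [Order.cof_ne_one_iff, noTopOrder_iff_noMaxOrder] at h1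
  rw [Order.cof_ne_zero_iff] at h0
  obtain ⟨b, hb⟩ := h0
  refine ⟨fun h => (h hb.le).not_gt hb, fun a ha => ?_⟩
  obtain ⟨d, hd⟩ := exists_gt (⟨a, ha.lt⟩ : Iio x)
  exact ha.2 (c := d) hd d.2

theorem Order.IsNormal.cof_Iio_map {α : Type*} [LinearOrder α] {f : α → α} (hf : IsNormal f)
    {x : α} (hx : IsSuccLimit x) : Order.cof (Iio (f x)) = Order.cof (Iio x) := by
  let g : Iio x → Iio (f x) := fun a => ⟨f a, hf.strictMono a.2⟩
  have hg : StrictMono g := fun a b hab => hf.strictMono hab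
  refine (cof_congr_of_strictMono hg ?_).symm
  rintro ⟨b, hb⟩
  obtain ⟨a, ha, hab⟩ := (hf.lt_iff_exists_lt hx).1 hb
  exact ⟨_, ⟨⟨a, ha⟩, rfl⟩, hab.le⟩

theorem Cardinal.IsRegular.isStationary_cof_eq (hκ : κ.IsRegular) {c : Cardinal.{u}}
    (hc : c.IsRegular) (hcκ : c < κ) : IsStationary {x : CardSet κ | Order.cof (Iio x) = c} := by
  intro C hC
  have := hκ.isRegularCardinalOrder
  obtain ⟨x, hx⟩ := hc.exists_cof_Iio_eq hcκ
  -- The enumeration of a club is normal, so it preserves cofinality at limits.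
  refine ⟨_, ?_, (Order.enum C hC.isCofinal x).2⟩
  exact (hC.isNormal_enum.cof_Iio_map (isSuccLimit_of_aleph0_le_cof (hx ▸ hc.aleph0_le))).trans hx

theorem Cardinal.IsRegular.exists_injective_regular (hκ : κ.IsRegular) (hunc : ℵ₀ < κ)
    (hlim : ∀ c < κ, 2 ^ c < κ) :
    ∃ e : CardSet κ → Cardinal.{u}, Function.Injective e ∧ ∀ x, (e x).IsRegular ∧ e x < κ := by
  let R : Set (CardSet κ) :=
    {x | ∃ c : Cardinal.{u}, c.IsRegular ∧ c < κ ∧ Ordinal.typein (α := CardSet κ) (· < ·) x = c.ord}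
  have hR : ¬ BddAbove R := by
    rintro ⟨a, ha⟩
    let b := max ℵ₀ #(Iio a)
    have hb : b < κ := max_lt hunc (mk_Iio_cardSet_lt a)
    have hs : succ b < κ := (succ_le_of_lt (cantor b)).trans_lt (hlim b hb)
    have h : (succ b).ord < Ordinal.type (α := CardSet κ) (· < ·) := by
      rwa [Ordinal.type_toType, ord_lt_ord]
    have hmem := ha (a := Ordinal.enum (α := CardSet κ) (· < ·) ⟨_, h⟩)
      ⟨succ b, isRegular_succ (le_max_left _ _), hs, Ordinal.typein_enum _ _⟩
    have hcard : #(Iio (Ordinal.enum (α := CardSet κ) (· < ·) ⟨_, h⟩)) = succ b := by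
      have := congrArg Ordinal.card (Ordinal.typein_enum (α := CardSet κ) (· < ·) h)
      rwa [Ordinal.card_typein, Cardinal.card_ord] at this
    have := (mk_le_mk_of_subset (Iio_subset_Iio hmem)).trans (le_max_right ℵ₀ _)
    exact (hcard ▸ this).not_gt (lt_succ b)
  have hRκ : #R = #(CardSet κ) := (hκ.mk_eq_of_not_bddAbove hR).trans (mk_cardSet κ).symm
  obtain ⟨i⟩ := Cardinal.eq.1 hRκ
  choose c hc hcκ hceq using fun x : R => x.2
  refine ⟨fun x => c (i.symm x), fun x y hxy => i.symm.injective (Subtype.ext ?_),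
    fun x => ⟨hc _, hcκ _⟩⟩
  apply Ordinal.typein_injective (α := CardSet κ) (· < ·)
  rw [hceq, hceq]
  exact congrArg Cardinal.ord hxy

/-- If `κ` is inaccessible, then every nonempty set of cardinality at most `κ` indexes a
family of disjoint stationary subsets of `κ`. -/
theorem Cardinal.IsRegular.exists_stationary_fibers (hκ : κ.IsRegular) (hunc : ℵ₀ < κ)
    (hlim : ∀ c < κ, 2 ^ c < κ) {P : Type u} [Nonempty P] (hP : #P ≤ κ) :
    ∃ h : CardSet κ → P, ∀ p, IsStationary (h ⁻¹' {p}) := by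
  obtain ⟨e, he, hreg⟩ := hκ.exists_injective_regular hunc hlim
  rw [← mk_cardSet κ] at hP
  obtain ⟨i⟩ := hP
  have hinj : Function.Injective (e ∘ i) := he.comp i.injective
  refine ⟨fun x => Function.invFun (e ∘ i) (Order.cof (Iio x)), fun p => ?_⟩
  refine (hκ.isStationary_cof_eq (hreg (i p)).1 (hreg (i p)).2).mono fun x hx => ?_
  rw [mem_preimage, (hx : Order.cof (Iio x) = e (i p))]
  exact Function.leftInverse_invFun hinj p

/-! ### Independent families -/

/-- Hausdorff's independent family, modulo the club filter of an inaccessible cardinal. -/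
theorem Cardinal.IsRegular.exists_independent_family (hκ : κ.IsRegular) (hunc : ℵ₀ < κ)
    (hlim : ∀ c < κ, 2 ^ c < κ) :
    ∃ A : Set (CardSet κ) → Set (CardSet κ), ∀ s t : Set (Set (CardSet κ)), #s < κ → #t < κ →
      Disjoint s t → IsStationary {a | (∀ x ∈ s, a ∈ A x) ∧ ∀ y ∈ t, a ∉ A y} := by
  have := hκ.nonempty_cardSet
  have hP : #(Σ d : CardSet κ, Set (Set (Iio d))) ≤ κ := by
    rw [mk_sigma]
    refine (Cardinal.sum_le_mk_mul_iSup _).trans ?_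
    rw [mk_cardSet]
    refine (mul_le_mul' le_rfl (ciSup_le' fun d => ?_)).trans (mul_eq_self hκ.aleph0_le).le
    rw [mk_set, mk_set]
    exact (hlim _ (hlim _ (mk_Iio_cardSet_lt d))).le
  have : Nonempty (Σ d : CardSet κ, Set (Set (Iio d))) := ⟨⟨Classical.arbitrary _, ∅⟩⟩
  obtain ⟨h, hh⟩ := hκ.exists_stationary_fibers hunc hlim hP
  -- A code is a `d` with a family of subsets of `Iio d`; it accepts `x` when the trace of `x` on
  -- `Iio d` is in the family.
  let B (p : Σ d : CardSet κ, Set (Set (Iio d))) (x : Set (CardSet κ)) : Prop :=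
    Subtype.val ⁻¹' x ∈ p.2
  refine ⟨fun x => {a | B (h a) x}, fun s t hs ht hst => ?_⟩
  have hne : ∀ p : s × t, ∃ d, ¬ (d ∈ p.1.1 ↔ d ∈ p.2.1) := fun p => by
    by_contra! hp
    exact disjoint_left.1 hst p.1.2 (Set.ext hp ▸ p.2.2)
  choose f hf using hne
  -- Below `d`, the trace of every member of `s` already differs from that of every member of `t`.
  obtain ⟨d, hd⟩ := hκ.exists_forall_range_lt
    ((mk_prod _ _).trans_lt (by simpa using mul_lt_of_lt hκ.aleph0_le hs ht)) f
  refine (hh ⟨d, (fun x => Subtype.val ⁻¹' x) '' s⟩).mono fun a ha => ?_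
  rw [mem_preimage, mem_singleton_iff] at ha
  change (∀ x ∈ s, B (h a) x) ∧ ∀ y ∈ t, ¬ B (h a) y
  rw [ha]
  refine ⟨fun x hx => ⟨x, hx, rfl⟩, fun y hy => ?_⟩
  rintro ⟨x, hx, hxy⟩
  have := Set.ext_iff.1 hxy ⟨f (⟨x, hx⟩, ⟨y, hy⟩), hd _⟩
  exact hf (⟨x, hx⟩, ⟨y, hy⟩) this

end RegularCardinalOrder

/-! ### Tukey reductions -/

theorem TukeyLE.trans {P : Type*} {Q : Type*} {R : Type*} [Preorder P] [Preorder Q] [Preorder R]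
    (h₁ : TukeyLE P Q) (h₂ : TukeyLE Q R) : TukeyLE P R := by
  obtain ⟨f, hf⟩ := h₁
  obtain ⟨g, hg⟩ := h₂
  exact ⟨f ∘ g, fun X hX => image_comp f g X ▸ hf _ (hg X hX)⟩

section

variable {κ : Cardinal.{u}}

/-- A `κ`-complete ultrafilter on `κ` is Tukey below `[2^κ]^{<κ}`. -/
theorem tukeyLE_smallSubsets (hκ : κ.IsRegular) (U : Ultrafilter (CardSet κ))
    (hU : CardinalInterFilter (U : Filter (CardSet κ)) κ) :
    TukeyLE (ReverseInclusion U) (SmallSubsets (CardSet (2 ^ κ)) κ) := by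
  obtain ⟨e⟩ : Nonempty (CardSet (2 ^ κ) ≃ Set (CardSet κ)) := by
    rw [← Cardinal.eq, mk_cardSet, mk_set, mk_cardSet]
  have hmem (s : SmallSubsets (CardSet (2 ^ κ)) κ) :
      ⋂₀ {A | A ∈ U ∧ e.symm A ∈ s.1} ∈ (U : Filter (CardSet κ)) := by
    refine (cardinal_sInter_mem (lt_of_le_of_lt ?_ s.2)).2 fun A hA => hA.1
    exact mk_le_of_injective (f := fun A => (⟨e.symm A.1, A.2.2⟩ : s.1))
      fun A B hAB => Subtype.ext (e.symm.injective (congrArg Subtype.val hAB))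
  refine ⟨fun s => OrderDual.toDual ⟨_, hmem s⟩, fun X hX A => ?_⟩
  have hsm : #({e.symm (OrderDual.ofDual A).1} : Set (CardSet (2 ^ κ))) < κ := by
    rw [mk_singleton]
    exact_mod_cast hκ.nat_lt 1
  obtain ⟨s, hs, hAs⟩ := hX ⟨_, hsm⟩
  exact ⟨_, ⟨s, hs, rfl⟩, sInter_subset_of_mem
    ⟨(OrderDual.ofDual A).2, hAs (mem_singleton _)⟩⟩

/-- If `U` contains `2^κ` many sets no `κ` of which have an intersection in `U`, then
`[2^κ]^{<κ}` is Tukey below `U`. -/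
theorem smallSubsets_tukeyLE (U : Ultrafilter (CardSet κ))
    (hU : CardinalInterFilter (U : Filter (CardSet κ)) κ)
    {A : Set (CardSet κ) → Set (CardSet κ)} (hA : ∀ x, A x ∈ U)
    (hAI : ∀ I : Set (Set (CardSet κ)), κ ≤ #I → (⋂ x ∈ I, A x) ∉ U) :
    TukeyLE (SmallSubsets (CardSet (2 ^ κ)) κ) (ReverseInclusion U) := by
  obtain ⟨e⟩ : Nonempty (CardSet (2 ^ κ) ≃ Set (CardSet κ)) := by
    rw [← Cardinal.eq, mk_cardSet, mk_set, mk_cardSet]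
  -- The cofinal map sends `B` to the indices of the family's sets that contain it.
  have hsm (B : ReverseInclusion U) : #{i | (OrderDual.ofDual B).1 ⊆ A (e i)} < κ := by
    by_contra! h
    refine hAI (e '' {i | (OrderDual.ofDual B).1 ⊆ A (e i)}) ?_ ?_
    · rwa [mk_image_eq e.injective]
    · refine mem_of_superset (OrderDual.ofDual B).2 (subset_iInter₂ ?_)
      rintro _ ⟨i, hi, rfl⟩
      exact hi
  refine ⟨fun B => ⟨_, hsm B⟩, fun X hX s => ?_⟩
  have hs : (⋂ i ∈ s.1, A (e i)) ∈ (U : Filter (CardSet κ)) :=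
    (cardinal_bInter_mem s.2).2 fun i _ => hA (e i)
  obtain ⟨B, hB, hsB⟩ := hX (OrderDual.toDual ⟨_, hs⟩)
  refine ⟨_, ⟨B, hB, rfl⟩, fun i hi => ?_⟩
  exact Subset.trans hsB (iInter₂_subset i hi)

/-! ### Ultrafilters extending the club filter -/

theorem isUniformUltrafilter_of_isClub_mem (hκ : κ.IsRegular) {U : Ultrafilter (CardSet κ)}
    (hU : ∀ C, IsClub C → C ∈ U) : IsUniformUltrafilter U := by
  intro A hA
  have := hκ.noMaxOrder_cardSet
  refine hκ.mk_eq_of_not_bddAbove ?_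
  rintro ⟨a, ha⟩
  obtain ⟨b, hb⟩ := exists_gt a
  obtain ⟨x, hxA, hxb⟩ := Ultrafilter.nonempty_of_mem (inter_mem hA (hU _ (isClub_Ici b)))
  exact ((ha hxA).trans_lt hb).not_ge hxb

/-- Let `g` bound the fibres of `f` on `A`. If `y ∈ A` is closed under `g ∘ f` and `x < y` has `f x
= f y`, then `y ≤ g (f x) < y`, a contradiction. -/
theorem isQPoint_of_isClub_mem (hκ : κ.IsRegular) (hunc : ℵ₀ < κ) {U : Ultrafilter (CardSet κ)}
    (hU : ∀ C, IsClub C → C ∈ U) : IsQPoint U := by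
  rintro f ⟨A, hA, hf⟩
  choose g hg using hf
  refine ⟨_, inter_mem hA (hU _ (hκ.isClub_closedUnder hunc (g ∘ f))), ?_⟩
  have key : ∀ x, ∀ y ∈ A, (∀ b < y, g (f b) < y) → f x = f y → y ≤ x := by
    intro x y hy hyC hxy
    by_contra! hlt
    exact (hyC x hlt).not_ge (hg _ ⟨hy, hxy.symm⟩)
  intro x hx y hy hxy
  exact (key y x hx.1 hx.2 hxy.symm).antisymm (key x y hy.1 hy.2 hxy)

/-- If every `κ`-complete filter on `κ` extends to a `κ`-complete ultrafilter, then some such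
ultrafilter extends the club filter and contains `2^κ` many sets no `κ` of which have an
intersection in it. -/
theorem IsKappaCompact.exists_ultrafilter (hκ : κ.IsRegular) (hunc : ℵ₀ < κ)
    (hcomp : IsKappaCompact κ) :
    ∃ U : Ultrafilter (CardSet κ), CardinalInterFilter (U : Filter (CardSet κ)) κ ∧
      (∀ C, IsClub C → C ∈ U) ∧ ∃ A : Set (CardSet κ) → Set (CardSet κ), (∀ x, A x ∈ U) ∧
        ∀ I : Set (Set (CardSet κ)), κ ≤ #I → (⋂ x ∈ I, A x) ∉ U := by
  have := hκ.nonempty_cardSet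
  obtain ⟨A, hA⟩ := hκ.exists_independent_family hunc fun c => hcomp.two_power_lt hκ
  let G : Set (Set (CardSet κ)) :=
    {C | IsClub C} ∪ (range A ∪ {B | ∃ I : Set (Set (CardSet κ)), κ ≤ #I ∧ (⋂ x ∈ I, A x)ᶜ = B})
  have hne : (cardinalGenerate G (hκ.nat_lt 2)).NeBot := by
    rw [neBot_iff, ne_eq, ← empty_mem_iff_bot, mem_cardinalGenerate_iff (hreg := hκ)]
    rintro ⟨S, hSG, hS, hemp⟩
    have hsub : ∀ T ⊆ S, #T < κ := fun T hT => (mk_le_mk_of_subset hT).trans_lt hS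
    let S₂ : Set (Set (CardSet κ)) := S ∩ range A
    let S₃ : Set (Set (CardSet κ)) :=
      S ∩ {B | ∃ I : Set (Set (CardSet κ)), κ ≤ #I ∧ (⋂ x ∈ I, A x)ᶜ = B}
    choose x hx using fun B : S₂ => B.2.2
    choose I hI hIB using fun B : S₃ => B.2.2
    have hs : #(range x) < κ := mk_range_le.trans_lt (hsub S₂ inter_subset_left)
    -- To leave an intersection it suffices to avoid one of its sets; with fewer than `κ` indices
    -- required positively, a fresh one exists.
    have hy : ∀ B, ∃ y ∈ I B, y ∉ range x := fun B => by
      by_contra! h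
      exact ((hI B).trans (mk_le_mk_of_subset h)).not_gt hs
    choose y hyI hyx using hy
    have ht : #(range y) < κ := mk_range_le.trans_lt (hsub S₃ inter_subset_left)
    have hdisj : Disjoint (range x) (range y) := by
      rw [disjoint_right]
      rintro _ ⟨B, rfl⟩
      exact hyx B
    have hclub : IsClub (⋂₀ (S ∩ {C | IsClub C})) := by
      refine IsClub.sInter ?_ ?_ fun C hC => hC.2
      · rw [hκ.cof_cardSet]
        exact hunc.ne'
      · rw [hκ.cof_cardSet]
        exact hsub _ inter_subset_left
    obtain ⟨a, ⟨hax, hay⟩, haC⟩ := hA _ _ hs ht hdisj hclub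
    refine hemp (mem_sInter.2 fun B hB => ?_ : a ∈ ⋂₀ S)
    rcases hSG hB with hBC | hBA | hBI
    · exact haC B ⟨hB, hBC⟩
    · exact (hx ⟨B, hB, hBA⟩).subset (hax _ ⟨_, rfl⟩)
    · refine (hIB ⟨B, hB, hBI⟩).subset fun ha => ?_
      exact hay _ ⟨_, rfl⟩ (mem_iInter₂.1 ha _ (hyI ⟨B, hB, hBI⟩))
  obtain ⟨U, hUc, hU⟩ := hcomp _ hne (cardinalInter_ofCardinalGenerate G _)
  have hG : G ⊆ (U : Filter (CardSet κ)).sets :=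
    (le_cardinalGenerate_iff_of_cardinalInterFilter _).1 hU
  refine ⟨U, hUc, fun C hC => hG (.inl hC), A, fun x => hG (.inr (.inl ⟨x, rfl⟩)), fun I hI => ?_⟩
  exact Ultrafilter.compl_mem_iff_notMem.1 (hG (.inr (.inr ⟨I, hI, rfl⟩)))

end

theorem corollary2p23 (κ : Cardinal.{u}) (hreg : κ.IsRegular) (hunc : ℵ₀ < κ)
    (hcomp : IsKappaCompact κ) :
    ∃ U : Ultrafilter (CardSet κ),
      CardinalInterFilter (U : Filter (CardSet κ)) κ ∧
      IsUniformUltrafilter U ∧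
      IsQPoint U ∧
      IsTukeyTop U ∧
      ∀ W : Ultrafilter (CardSet κ), CardinalInterFilter (W : Filter (CardSet κ)) κ →
        TukeyLE (ReverseInclusion W) (ReverseInclusion U) := by
  obtain ⟨U, hUc, hclub, A, hA, hAI⟩ := hcomp.exists_ultrafilter hreg hunc
  have htop := smallSubsets_tukeyLE U hUc hA hAI
  exact ⟨U, hUc, isUniformUltrafilter_of_isClub_mem hreg hclub,
    isQPoint_of_isClub_mem hreg hunc hclub, ⟨tukeyLE_smallSubsets hreg U hUc, htop⟩,
    fun W hW => (tukeyLE_smallSubsets hreg W hW).trans htop⟩
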